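/- Let $n\ge 3$ and consider a convex $n$-gon with labelled vertices. For $0\le m\le n-3$, an $m$-dissection of the $n$-gon is a partition of it into $m+1$ polygons by $m$ pairwise noncrossing diagonals (two diagonals are noncrossing if they have no common interior point); a triangulation is an $(n-3)$-dissection. Two dissections are the same if and only if they use the same set of diagonals. For $4\le k\le n$, a $k$-in-$n$ dissection is an $(n-k)$-dissection of the $n$-gon whose parts are one $k$-gon and $n-k$ triangles. A $3$-in-$n$ dissection is a triangulation of the $n$-gon together with a choice of one of its $n-2$ triangles (the marked triangle). Let $f_k(n)$ denote the number of $k$-in-$n$ dissections. **Theorem.** For all integers $3\le k\le n$, $$f_k(n)=\binom{2n-k-1}{n-1}.$$ -/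

import Mathlib

/-! Dissections of a convex `n`-gon whose vertices are labelled `0, 1, …, n - 1` in cyclic order.
A segment between two distinct vertices `i < j` is recorded as the pair `(i, j)`. -/

namespace PolygonDissection

/-- `e = (i, j)` is a side of the convex polygon with vertex set `P`: `i < j` are vertices in `P`
that are cyclically consecutive in `P`, i.e. no vertex of `P` lies strictly between them, or
no vertex of `P` lies outside the range from `i` to `j`. -/
def IsSide {n : ℕ} (P : Finset (Fin n)) (e : Fin n × Fin n) : Prop :=
  e.1 ∈ P ∧ e.2 ∈ P ∧ e.1 < e.2 ∧
    ((∀ x ∈ P, ¬ (e.1 < x ∧ x < e.2)) ∨ (∀ x ∈ P, e.1 ≤ x ∧ x ≤ e.2))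

/-- `e = (i, j)` with `i < j` is a diagonal of the convex polygon with vertex set `P`: it joins
two distinct vertices of `P` and is not a side. -/
def IsDiagonal {n : ℕ} (P : Finset (Fin n)) (e : Fin n × Fin n) : Prop :=
  e.1 ∈ P ∧ e.2 ∈ P ∧ e.1 < e.2 ∧ ¬ IsSide P e

/-- Two segments cross (meet in a common interior point) iff their endpoints strictly
interleave. -/
def Crosses {n : ℕ} (e f : Fin n × Fin n) : Prop :=
  (e.1 < f.1 ∧ f.1 < e.2 ∧ e.2 < f.2) ∨ (f.1 < e.1 ∧ e.1 < f.2 ∧ f.2 < e.2)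

/-- `D` is (the set of diagonals of) an `m`-dissection of the `n`-gon: `m` pairwise noncrossing
diagonals of the `n`-gon. -/
def IsDissection {n : ℕ} (m : ℕ) (D : Finset (Fin n × Fin n)) : Prop :=
  D.card = m ∧ (∀ e ∈ D, IsDiagonal Finset.univ e) ∧ (∀ e ∈ D, ∀ f ∈ D, ¬ Crosses e f)

/-- The polygon with vertex set `P` is one of the parts into which the diagonals in `D` cut the
`n`-gon: each of its sides is a side of the `n`-gon or belongs to `D`, and none of its
diagonals belongs to `D` (so it is not cut any further). -/
def IsPart {n : ℕ} (D : Finset (Fin n × Fin n)) (P : Finset (Fin n)) : Prop :=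
  3 ≤ P.card ∧ (∀ e, IsSide P e → IsSide Finset.univ e ∨ e ∈ D) ∧ (∀ e, IsDiagonal P e → e ∉ D)

instance {n : ℕ} (P : Finset (Fin n)) (e : Fin n × Fin n) : Decidable (IsSide P e) := by
  unfold IsSide; infer_instance

instance {n : ℕ} (P : Finset (Fin n)) (e : Fin n × Fin n) : Decidable (IsDiagonal P e) := by
  unfold IsDiagonal; infer_instance

instance {n : ℕ} (e f : Fin n × Fin n) : Decidable (Crosses e f) := by
  unfold Crosses; infer_instance

instance {n : ℕ} (m : ℕ) (D : Finset (Fin n × Fin n)) : Decidable (IsDissection m D) := by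
  unfold IsDissection; infer_instance

instance {n : ℕ} (D : Finset (Fin n × Fin n)) (P : Finset (Fin n)) : Decidable (IsPart D P) := by
  unfold IsPart; infer_instance

/-- The parts of the `n`-gon cut out by `D`, each given by its vertex set. -/
def parts {n : ℕ} (D : Finset (Fin n × Fin n)) : Finset (Finset (Fin n)) :=
  Finset.univ.filter (fun P => IsPart D P)

/-- A triangulation of the `n`-gon is an `(n - 3)`-dissection. -/
def IsTriangulation {n : ℕ} (D : Finset (Fin n × Fin n)) : Prop :=
  IsDissection (n - 3) D

/-- For `4 ≤ k ≤ n`: `D` is an `(n - k)`-dissection of the `n`-gon whose parts are one `k`-gon and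
`n - k` triangles. -/
def IsKInN {n : ℕ} (k : ℕ) (D : Finset (Fin n × Fin n)) : Prop :=
  IsDissection (n - k) D ∧
    (parts D).val.map Finset.card = k ::ₘ Multiset.replicate (n - k) 3

/-- A `3`-in-`n` dissection: a triangulation `p.1` together with a marked triangle `p.2` of it. -/
def IsMarkedTriangulation {n : ℕ} (p : Finset (Fin n × Fin n) × Finset (Fin n)) : Prop :=
  IsTriangulation p.1 ∧ p.2 ∈ parts p.1 ∧ p.2.card = 3

instance {n : ℕ} (D : Finset (Fin n × Fin n)) : Decidable (IsTriangulation D) := by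
  unfold IsTriangulation; infer_instance

instance {n : ℕ} (k : ℕ) (D : Finset (Fin n × Fin n)) : Decidable (IsKInN k D) := by
  unfold IsKInN; infer_instance

instance {n : ℕ} (p : Finset (Fin n × Fin n) × Finset (Fin n)) :
    Decidable (IsMarkedTriangulation p) := by
  unfold IsMarkedTriangulation; infer_instance

/-- `f_k(n)`, the number of `k`-in-`n` dissections (`3 ≤ k ≤ n`). -/
def f (k n : ℕ) : ℕ :=
  if k = 3 then
    (Finset.univ.filter
      (fun p : Finset (Fin n × Fin n) × Finset (Fin n) => IsMarkedTriangulation p)).card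
  else
    (Finset.univ.filter (fun D : Finset (Fin n × Fin n) => IsKInN k D)).card

end PolygonDissection

/-! Orient the polygon and mark the `k`-gon (for `k = 3`, the marked triangle) `P`. Every diagonal
cuts off from `P` an arc of vertices; call the endpoint at which this arc starts the source of the
diagonal. The `n - k` sources form a multiset `M` of vertices, and `M` determines the dissection:
if `a ∈ M` while the next vertex `v` is not in `M`, then no diagonal ends at `v`, so `v` is the tip
of a triangle cut off by the diagonal joining its two neighbours. Removing `v` from the polygon and
one copy of `a` from `M` continues the reconstruction, and conversely every multiset of `n - k`
vertices arises by reattaching such triangles. There are `(n + (n - k) - 1).choose (n - k)` of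
these multisets. -/

namespace PolygonDissection

section CircularOrder

variable {α : Type*}

theorem exists_mem_ne_ne {V : Finset α} (hV : 3 ≤ V.card) (a b : α) :
    ∃ x ∈ V, x ≠ a ∧ x ≠ b := by
  classical
  obtain ⟨x, hxV, hx⟩ := Finset.exists_mem_notMem_of_card_lt_card
    (Finset.card_le_two.trans_lt hV : ({a, b} : Finset α).card < V.card)
  exact ⟨x, hxV, by simpa using hx⟩

variable [CircularOrder α] {V W : Finset α} {a b v w x y : α}

theorem sbtw_or_sbtw (hab : a ≠ b) (hbv : b ≠ v) (hva : v ≠ a) : sbtw a b v ∨ sbtw b a v := by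
  by_contra! h
  simp only [sbtw_iff_not_btw, not_not] at h
  rcases h.1.antisymm h.2.cyclic_left with h | h | h
  exacts [hbv h.symm, hab h.symm, hva h.symm]

theorem exists_sbtw_of_not_sbtw (hV : 3 ≤ V.card) (hab : a ≠ b) (h : ∀ x ∈ V, ¬ sbtw a x b) :
    ∃ x ∈ V, sbtw b x a := by
  obtain ⟨x, hx, hxa, hxb⟩ := exists_mem_ne_ne hV a b
  exact ⟨x, hx, ((sbtw_or_sbtw hxa.symm hxb hab.symm).resolve_left (h x hx)).cyclic_right⟩

/-- The vertices of `V` strictly between `a` and `b` in the positive direction. -/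
noncomputable def arc (V : Finset α) (a b : α) : Finset α :=
  open Classical in V.filter (sbtw a · b)

theorem mem_arc : x ∈ arc V a b ↔ x ∈ V ∧ sbtw a x b := by
  classical exact Finset.mem_filter

theorem arc_ssubset_arc_left (hv : v ∈ arc V a b) : arc V v b ⊂ arc V a b := by
  refine (Finset.ssubset_iff_of_subset fun x hx ↦ ?_).2 ⟨v, hv, ?_⟩
  · exact mem_arc.2 ⟨(mem_arc.1 hx).1, (mem_arc.1 hv).2.trans_left (mem_arc.1 hx).2⟩
  · exact fun h ↦ sbtw_irrefl_left (mem_arc.1 h).2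

theorem arc_ssubset_arc_right (hv : v ∈ arc V a b) : arc V a v ⊂ arc V a b := by
  refine (Finset.ssubset_iff_of_subset fun x hx ↦ ?_).2 ⟨v, hv, ?_⟩
  · exact mem_arc.2 ⟨(mem_arc.1 hx).1, (mem_arc.1 hx).2.trans_right (mem_arc.1 hv).2⟩
  · exact fun h ↦ sbtw_irrefl_right (mem_arc.1 h).2

/-- `b` immediately follows `a` in the circular order on the vertex set `V`. -/
structure Consecutive (V : Finset α) (a b : α) : Prop where
  left_mem : a ∈ V
  right_mem : b ∈ V
  ne : a ≠ b
  not_sbtw : ∀ x ∈ V, ¬ sbtw a x b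

theorem Consecutive.mono (h : Consecutive V a b) (hWV : W ⊆ V) (ha : a ∈ W) (hb : b ∈ W) :
    Consecutive W a b :=
  ⟨ha, hb, h.ne, fun x hx ↦ h.not_sbtw x (hWV hx)⟩

theorem Consecutive.right_unique (hv : Consecutive V a v) (hw : Consecutive V a w) : v = w := by
  by_contra hvw
  rcases sbtw_or_sbtw hvw hw.ne.symm hv.ne with h | h
  · exact hw.not_sbtw v hv.right_mem h.cyclic_right
  · exact hv.not_sbtw w hw.right_mem h.cyclic_right

theorem Consecutive.left_unique (hv : Consecutive V v b) (hw : Consecutive V w b) : v = w := by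
  by_contra hvw
  rcases sbtw_or_sbtw hvw hw.ne hv.ne.symm with h | h
  · exact hv.not_sbtw w hw.left_mem h
  · exact hw.not_sbtw v hv.left_mem h

theorem Consecutive.asymm (hV : 3 ≤ V.card) (hab : Consecutive V a b) : ¬ Consecutive V b a := by
  intro hba
  obtain ⟨x, hx, h⟩ := exists_sbtw_of_not_sbtw hV hab.ne hab.not_sbtw
  exact hba.not_sbtw x hx h

theorem exists_consecutive_of_not {p : α → Prop} {x y : α} (hx : x ∈ V) (hpx : p x)
    (hy : y ∈ V) (hpy : ¬ p y) : ∃ a b, Consecutive V a b ∧ p a ∧ ¬ p b := by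
  rcases (arc V x y).eq_empty_or_nonempty with hxy | ⟨z, hz⟩
  · refine ⟨x, y, ⟨hx, hy, fun h ↦ hpy (h ▸ hpx), fun z hz hxzy ↦ ?_⟩, hpx, hpy⟩
    exact Finset.eq_empty_iff_forall_notMem.1 hxy z (mem_arc.2 ⟨hz, hxzy⟩)
  · by_cases hpz : p z
    · exact exists_consecutive_of_not (mem_arc.1 hz).1 hpz hy hpy
    · exact exists_consecutive_of_not hx hpx (mem_arc.1 hz).1 hpz
termination_by (arc V x y).card
decreasing_by
  · exact Finset.card_lt_card (arc_ssubset_arc_left hz)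
  · exact Finset.card_lt_card (arc_ssubset_arc_right hz)

theorem exists_consecutive_left (hV : 3 ≤ V.card) (ha : a ∈ V) : ∃ b, Consecutive V a b := by
  obtain ⟨x, hx, hxa, -⟩ := exists_mem_ne_ne hV a a
  obtain ⟨_, b, hab, rfl, -⟩ := exists_consecutive_of_not (p := (· = a)) ha rfl hx hxa
  exact ⟨b, hab⟩

theorem exists_consecutive_right (hV : 3 ≤ V.card) (hb : b ∈ V) : ∃ a, Consecutive V a b := by
  obtain ⟨x, hx, hxb, -⟩ := exists_mem_ne_ne hV b b
  obtain ⟨a, _, hab, -, h⟩ :=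
    exists_consecutive_of_not (p := (· ≠ b)) hx hxb hb (not_not.2 rfl)
  exact ⟨a, not_not.1 h ▸ hab⟩

/-- Three consecutive vertices of `V`; the triangle on them is cut off by the chord `a b`. -/
structure Ear (V : Finset α) (a v b : α) : Prop where
  left : Consecutive V a v
  right : Consecutive V v b
  ne : a ≠ b

theorem Consecutive.exists_ear (hV : 3 ≤ V.card) (h : Consecutive V a v) : ∃ b, Ear V a v b := by
  obtain ⟨b, hb⟩ := exists_consecutive_left hV h.right_mem
  exact ⟨b, h, hb, by rintro rfl; exact h.asymm hV hb⟩

theorem Ear.sbtw_tip (hE : Ear V a v b) : sbtw a v b :=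
  (sbtw_or_sbtw hE.left.ne hE.right.ne hE.ne.symm).resolve_right fun h ↦
    hE.right.not_sbtw a hE.left.left_mem h

theorem Ear.eq_of_sbtw (hE : Ear V a v b) (hx : x ∈ V) (h : sbtw a x b) : x = v := by
  by_contra hxv
  rcases sbtw_or_sbtw (fun hax ↦ sbtw_irrefl_left (hax ▸ h)) hxv hE.left.ne.symm with h' | h'
  · exact hE.left.not_sbtw x hx h'
  · exact hE.right.not_sbtw x hx (h.cyclic_left.trans_right h').cyclic_right

variable [DecidableEq α]

theorem Ear.consecutive_erase (hE : Ear V a v b) : Consecutive (V.erase v) a b where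
  left_mem := Finset.mem_erase.2 ⟨hE.left.ne, hE.left.left_mem⟩
  right_mem := Finset.mem_erase.2 ⟨hE.right.ne.symm, hE.right.right_mem⟩
  ne := hE.ne
  not_sbtw _ hx h := Finset.ne_of_mem_erase hx (hE.eq_of_sbtw (Finset.mem_of_mem_erase hx) h)

theorem Ear.consecutive_of_erase (hE : Ear V a v b) (h : Consecutive (V.erase v) x y) :
    Consecutive V x y ∨ x = a ∧ y = b := by
  by_cases hv : sbtw x v y
  · right
    have ha : x = a := by
      by_contra hxa
      rcases sbtw_or_sbtw hxa hE.left.ne (Finset.ne_of_mem_erase h.left_mem).symm with h' | h'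
      · exact h.not_sbtw a hE.consecutive_erase.left_mem (h'.trans_right hv)
      · exact hE.left.not_sbtw x (Finset.mem_of_mem_erase h.left_mem) h'
    exact ⟨ha, h.right_unique (ha ▸ hE.consecutive_erase)⟩
  · refine .inl ⟨Finset.mem_of_mem_erase h.left_mem, Finset.mem_of_mem_erase h.right_mem, h.ne,
      fun z hz hxzy ↦ ?_⟩
    exact h.not_sbtw z (Finset.mem_erase.2 ⟨fun hzv ↦ hv (hzv ▸ hxzy), hz⟩) hxzy

theorem Ear.card_triple (hE : Ear V a v b) : ({a, v, b} : Finset α).card = 3 :=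
  Finset.card_eq_three.2 ⟨a, v, b, hE.left.ne, hE.ne, hE.right.ne, rfl⟩

end CircularOrder

section Chords

variable {n : ℕ} {V : Finset (Fin n)} {a b c d : Fin n}

/-- The segment between two vertices, in the encoding `(i, j)` with `i < j` of the segments of
a dissection. -/
def chord (a b : Fin n) : Fin n × Fin n :=
  (min a b, max a b)

theorem chord_comm (a b : Fin n) : chord a b = chord b a := by
  simp only [chord, min_comm, max_comm]

theorem chord_of_lt (h : a < b) : chord a b = (a, b) := by
  simp only [chord, min_eq_left h.le, max_eq_right h.le]

theorem chord_fst_snd {e : Fin n × Fin n} (h : e.1 < e.2) : chord e.1 e.2 = e :=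
  chord_of_lt h

theorem IsSide.mono {W : Finset (Fin n)} {e : Fin n × Fin n} (h : IsSide V e) (hWV : W ⊆ V)
    (h₁ : e.1 ∈ W) (h₂ : e.2 ∈ W) : IsSide W e :=
  ⟨h₁, h₂, h.2.2.1, h.2.2.2.imp (fun h x hx ↦ h x (hWV hx)) fun h x hx ↦ h x (hWV hx)⟩

theorem isSide_chord :
    IsSide V (chord a b) ↔ Consecutive V a b ∨ Consecutive V b a := by
  wlog hab : a ≤ b generalizing a b
  · rw [chord_comm, this (le_of_not_ge hab), or_comm]
  rcases hab.eq_or_lt with rfl | hlt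
  · exact ⟨fun h ↦ absurd h.2.2.1 (by simp [chord]), by rintro (h | h) <;> exact absurd rfl h.ne⟩
  have h₁ (x : Fin n) : sbtw a x b ↔ a < x ∧ x < b := by simp only [Fin.sbtw_iff]; grind
  have h₂ (x : Fin n) : ¬ sbtw b x a ↔ a ≤ x ∧ x ≤ b := by simp only [Fin.sbtw_iff]; grind
  rw [chord_of_lt hlt]
  constructor
  · rintro ⟨ha, hb, -, h | h⟩
    · exact .inl ⟨ha, hb, hlt.ne, fun x hx ↦ (h₁ x).not.2 (h x hx)⟩
    · exact .inr ⟨hb, ha, hlt.ne', fun x hx ↦ (h₂ x).2 (h x hx)⟩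
  · rintro (h | h)
    · exact ⟨h.left_mem, h.right_mem, hlt, .inl fun x hx ↦ (h₁ x).not.1 (h.not_sbtw x hx)⟩
    · exact ⟨h.right_mem, h.left_mem, hlt, .inr fun x hx ↦ (h₂ x).1 (h.not_sbtw x hx)⟩

theorem isDiagonal_chord :
    IsDiagonal V (chord a b) ↔
      a ∈ V ∧ b ∈ V ∧ (∃ x ∈ V, sbtw a x b) ∧ ∃ y ∈ V, sbtw b y a := by
  wlog hab : a ≤ b generalizing a b
  · rw [chord_comm, this (le_of_not_ge hab)]; tauto
  rcases hab.eq_or_lt with rfl | hlt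
  · simp [IsDiagonal, chord, sbtw_irrefl_left_right]
  have h : IsDiagonal V (chord a b) ↔ a ∈ V ∧ b ∈ V ∧ ¬ IsSide V (chord a b) := by
    rw [chord_of_lt hlt]; simp only [IsDiagonal]; tauto
  rw [h, isSide_chord]
  refine ⟨fun ⟨ha, hb, hs⟩ ↦ ⟨ha, hb, ?_, ?_⟩, fun ⟨ha, hb, ⟨x, hx, hab⟩, y, hy, hba⟩ ↦
    ⟨ha, hb, ?_⟩⟩
  · by_contra! hx
    exact hs (.inl ⟨ha, hb, hlt.ne, hx⟩)
  · by_contra! hy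
    exact hs (.inr ⟨hb, ha, hlt.ne', hy⟩)
  · rintro (h | h)
    exacts [h.not_sbtw x hx hab, h.not_sbtw y hy hba]

theorem crosses_chord :
    Crosses (chord a b) (chord c d) ↔ sbtw a c b ∧ sbtw b d a ∨ sbtw a d b ∧ sbtw b c a := by
  simp only [Crosses, chord, Fin.sbtw_iff]
  grind

theorem crosses_comm {e f : Fin n × Fin n} : Crosses e f ↔ Crosses f e :=
  or_comm

theorem not_crosses_of_isSide (h : IsSide V (chord a b)) (hc : c ∈ V) (hd : d ∈ V) :
    ¬ Crosses (chord a b) (chord c d) := by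
  rw [crosses_chord]
  rcases isSide_chord.1 h with h | h
  · rintro (h' | h')
    exacts [h.not_sbtw c hc h'.1, h.not_sbtw d hd h'.1]
  · rintro (h' | h')
    exacts [h.not_sbtw d hd h'.2, h.not_sbtw c hc h'.2]

theorem IsDiagonal.four_le_card {e : Fin n × Fin n} (h : IsDiagonal V e) : 4 ≤ V.card := by
  rw [← chord_fst_snd h.2.2.1] at h
  obtain ⟨ha, hb, ⟨x, hx, hax⟩, y, hy, hby⟩ := isDiagonal_chord.1 h
  have hcard : ({e.1, x, e.2, y} : Finset (Fin n)).card = 4 := by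
    simp only [Fin.sbtw_iff] at hax hby
    grind [Finset.card_insert_of_notMem]
  exact hcard.symm.trans_le (Finset.card_le_card (by simp [Finset.insert_subset_iff, *]))

theorem Ear.isSide_of_erase {v : Fin n} {e : Fin n × Fin n} (hE : Ear V a v b)
    (h : IsSide (V.erase v) e) : IsSide V e ∨ e = chord a b := by
  obtain ⟨x, y, rfl⟩ : ∃ x y, e = chord x y := ⟨e.1, e.2, (chord_fst_snd h.2.2.1).symm⟩
  rcases isSide_chord.1 h with h | h <;> rcases hE.consecutive_of_erase h with h | ⟨h₁, h₂⟩
  · exact .inl (isSide_chord.2 (.inl h))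
  · exact .inr (by rw [h₁, h₂])
  · exact .inl (isSide_chord.2 (.inr h))
  · exact .inr (by rw [h₁, h₂, chord_comm])

theorem Ear.isDiagonal_chord {v x : Fin n} (hE : Ear V a v b) (hx : x ∈ V) (hxa : x ≠ a)
    (hxv : x ≠ v) (hxb : x ≠ b) : IsDiagonal V (chord a b) := by
  refine PolygonDissection.isDiagonal_chord.2 ⟨hE.left.left_mem, hE.right.right_mem,
    ⟨v, hE.left.right_mem, hE.sbtw_tip⟩, x, hx, ?_⟩
  rcases sbtw_or_sbtw hxa.symm hxb hE.ne.symm with h | h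
  · exact absurd (hE.eq_of_sbtw hx h) hxv
  · exact h.cyclic_left.cyclic_left

end Chords

section MarkedDissection

variable {n : ℕ} {V P : Finset (Fin n)} {D : Finset (Fin n × Fin n)} {e : Fin n × Fin n}
  {a b v w x y : Fin n}

/-- `D` is a set of pairwise noncrossing diagonals of the polygon with vertex set `V`, and the
polygon with vertex set `P` is one of the parts into which they cut it. -/
structure MarkedDissection (V : Finset (Fin n)) (D : Finset (Fin n × Fin n))
    (P : Finset (Fin n)) : Prop where
  isDiagonal : ∀ e ∈ D, IsDiagonal V e
  not_crosses : ∀ e ∈ D, ∀ f ∈ D, ¬ Crosses e f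
  subset : P ⊆ V
  three_le_card : 3 ≤ P.card
  isSide : ∀ e, IsSide P e → IsSide V e ∨ e ∈ D
  notMem : ∀ e, IsDiagonal P e → e ∉ D

namespace MarkedDissection

protected theorem refl (h : 3 ≤ V.card) : MarkedDissection V ∅ V where
  isDiagonal := by simp
  not_crosses := by simp
  subset := subset_rfl
  three_le_card := h
  isSide _ he := .inl he
  notMem := by simp

theorem chord_fst_snd (h : MarkedDissection V D P) (he : e ∈ D) : chord e.1 e.2 = e :=
  PolygonDissection.chord_fst_snd (h.isDiagonal e he).2.2.1

theorem left_mem (h : MarkedDissection V D P) (he : chord a b ∈ D) : a ∈ V :=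
  (isDiagonal_chord.1 (h.isDiagonal _ he)).1

theorem right_mem (h : MarkedDissection V D P) (he : chord a b ∈ D) : b ∈ V :=
  (isDiagonal_chord.1 (h.isDiagonal _ he)).2.1

theorem exists_sbtw (h : MarkedDissection V D P) (he : chord a b ∈ D) : ∃ x ∈ V, sbtw a x b :=
  (isDiagonal_chord.1 (h.isDiagonal _ he)).2.2.1

theorem ne (h : MarkedDissection V D P) (he : chord a b ∈ D) : a ≠ b := by
  rintro rfl
  obtain ⟨x, -, hx⟩ := h.exists_sbtw he
  exact sbtw_irrefl_left_right hx

theorem chord_notMem (h : MarkedDissection V D P) (hab : Consecutive V a b) :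
    chord a b ∉ D := by
  intro he
  obtain ⟨x, hx, haxb⟩ := h.exists_sbtw he
  exact hab.not_sbtw x hx haxb

theorem consecutive (h : MarkedDissection V D P) (hab : Consecutive P a b)
    (he : chord a b ∉ D) : Consecutive V a b :=
  (isSide_chord.1 <| (h.isSide _ <| isSide_chord.2 (.inl hab)).resolve_right he).resolve_right
    fun hba ↦ hab.asymm h.three_le_card (hba.mono h.subset hab.right_mem hab.left_mem)

theorem not_crosses_of_consecutive (h : MarkedDissection V D P) (hxy : Consecutive P x y)
    (he : chord a b ∈ D) : ¬ Crosses (chord x y) (chord a b) := by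
  rcases h.isSide _ (isSide_chord.2 (.inl hxy)) with hs | hs
  · exact not_crosses_of_isSide hs (h.left_mem he) (h.right_mem he)
  · exact h.not_crosses _ hs _ he

theorem right_mem_of_sbtw_of_sbtw (h : MarkedDissection V D P) (he : chord a b ∈ D)
    (hx : x ∈ P) (haxb : sbtw a x b) (hy : y ∈ P) (hbya : sbtw b y a) : b ∈ P := by
  -- The side of `P` by which one leaves the arc from `a` to `b` can only do so through `b`.
  obtain ⟨p, q, hpq, hp, hq⟩ :=
    exists_consecutive_of_not (p := (sbtw a · b)) hx haxb hy hbya.not_sbtw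
  have hcross := h.not_crosses_of_consecutive hpq he
  have hpyq := hpq.not_sbtw y hy
  suffices hqb : q = b from hqb ▸ hpq.right_mem
  simp only [crosses_chord, Fin.sbtw_iff] at *
  grind

theorem not_sbtw_or_not_sbtw (h : MarkedDissection V D P) (he : chord a b ∈ D) :
    (∀ x ∈ P, ¬ sbtw a x b) ∨ ∀ x ∈ P, ¬ sbtw b x a := by
  by_contra! hc
  obtain ⟨⟨x, hx, haxb⟩, y, hy, hbya⟩ := hc
  have hb : b ∈ P := h.right_mem_of_sbtw_of_sbtw he hx haxb hy hbya
  have ha : a ∈ P := h.right_mem_of_sbtw_of_sbtw (chord_comm a b ▸ he) hy hbya hx haxb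
  exact h.notMem _ (isDiagonal_chord.2 ⟨ha, hb, ⟨x, hx, haxb⟩, y, hy, hbya⟩) he

theorem eq_or_sbtw_of_chord_mem_left (h : MarkedDissection V D P) (hab : chord a b ∈ D)
    (hPab : ∀ x ∈ P, ¬ sbtw a x b) (hv : sbtw a v b) (hvw : chord v w ∈ D)
    (hPvw : ∀ x ∈ P, ¬ sbtw v x w) : w = b ∨ sbtw v w b := by
  obtain ⟨p, hp, hbpa⟩ := exists_sbtw_of_not_sbtw h.three_le_card (h.ne hab) hPab
  -- Otherwise `v w` crosses `a b`, or the arcs from `v` to `w` and from `a` to `b` overlap so as to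
  -- cover the whole circle, leaving no room for `p`.
  have hvpw := hPvw p hp
  have hne := h.ne hvw
  have hcross := h.not_crosses _ hab _ hvw
  clear hPab hPvw
  simp only [crosses_chord, Fin.sbtw_iff] at *
  grind

theorem eq_or_sbtw_of_chord_mem_right (h : MarkedDissection V D P) (hab : chord a b ∈ D)
    (hPab : ∀ x ∈ P, ¬ sbtw a x b) (hv : sbtw a v b) (hwv : chord w v ∈ D)
    (hPwv : ∀ x ∈ P, ¬ sbtw w x v) : w = a ∨ sbtw a w v := by
  obtain ⟨p, hp, hbpa⟩ := exists_sbtw_of_not_sbtw h.three_le_card (h.ne hab) hPab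
  have hwpv := hPwv p hp
  have hne := h.ne hwv
  have hcross := h.not_crosses _ hab _ hwv
  clear hPab hPwv
  simp only [crosses_chord, Fin.sbtw_iff] at *
  grind

theorem exists_arc_ssubset (h : MarkedDissection V D P) (hab : chord a b ∈ D)
    (hPab : ∀ x ∈ P, ¬ sbtw a x b) (hv : v ∈ arc V a b) (hvw : chord v w ∈ D) :
    ∃ c d, chord c d ∈ D ∧ (∀ x ∈ P, ¬ sbtw c x d) ∧ arc V c d ⊂ arc V a b := by
  have havb := (mem_arc.1 hv).2
  rcases h.not_sbtw_or_not_sbtw hvw with hP | hP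
  · refine ⟨v, w, hvw, hP, ?_⟩
    rcases h.eq_or_sbtw_of_chord_mem_left hab hPab havb hvw hP with rfl | hw
    · exact arc_ssubset_arc_left hv
    · exact (arc_ssubset_arc_right (mem_arc.2 ⟨h.right_mem hvw, hw⟩)).trans
        (arc_ssubset_arc_left hv)
  · rw [chord_comm] at hvw
    refine ⟨w, v, hvw, hP, ?_⟩
    rcases h.eq_or_sbtw_of_chord_mem_right hab hPab havb hvw hP with rfl | hw
    · exact arc_ssubset_arc_right hv
    · exact (arc_ssubset_arc_left (mem_arc.2 ⟨h.left_mem hvw, hw⟩)).trans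
        (arc_ssubset_arc_right hv)

theorem exists_isolated_of_chord_mem (h : MarkedDissection V D P) (hab : chord a b ∈ D)
    (hPab : ∀ x ∈ P, ¬ sbtw a x b) : ∃ v ∈ V, v ∉ P ∧ ∀ w, chord v w ∉ D := by
  induction hs : arc V a b using Finset.strongInduction generalizing a b with
  | H s ih =>
    obtain ⟨v, hvV, hv⟩ := h.exists_sbtw hab
    by_cases hiso : ∀ w, chord v w ∉ D
    · exact ⟨v, hvV, fun hvP ↦ hPab v hvP hv, hiso⟩
    obtain ⟨w, hvw⟩ := not_forall_not.1 hiso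
    obtain ⟨c, d, hcd, hPcd, hlt⟩ := h.exists_arc_ssubset hab hPab (mem_arc.2 ⟨hvV, hv⟩) hvw
    exact ih _ (hs ▸ hlt) hcd hPcd rfl

theorem exists_isolated (h : MarkedDissection V D P) (hP : P ≠ V) :
    ∃ v ∈ V, v ∉ P ∧ ∀ w, chord v w ∉ D := by
  rcases D.eq_empty_or_nonempty with rfl | ⟨e, he⟩
  · obtain ⟨v, hv, hvP⟩ := Finset.exists_of_ssubset (h.subset.ssubset_of_ne hP)
    exact ⟨v, hv, hvP, fun w ↦ Finset.notMem_empty _⟩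
  · rw [← h.chord_fst_snd he] at he
    rcases h.not_sbtw_or_not_sbtw he with hP | hP
    · exact h.exists_isolated_of_chord_mem he hP
    · exact h.exists_isolated_of_chord_mem (chord_comm _ _ ▸ he) hP

end MarkedDissection

/-- An ear of `V` whose tip `v` is neither a vertex of `P` nor an endpoint of a segment in `D`, so
that `v` can be cut off without affecting `P`. -/
structure FreeEar (V : Finset (Fin n)) (D : Finset (Fin n × Fin n)) (P : Finset (Fin n))
    (a v b : Fin n) : Prop extends Ear V a v b where
  notMem : v ∉ P
  chord_notMem : ∀ w, chord v w ∉ D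

namespace MarkedDissection

theorem exists_freeEar (h : MarkedDissection V D P) (hP : P ≠ V) :
    ∃ a v b, FreeEar V D P a v b := by
  have hV := h.three_le_card.trans (Finset.card_le_card h.subset)
  obtain ⟨v, hv, hvP, hiso⟩ := h.exists_isolated hP
  obtain ⟨a, ha⟩ := exists_consecutive_right hV hv
  obtain ⟨b, hE⟩ := ha.exists_ear hV
  exact ⟨a, v, b, hE, hvP, hiso⟩

protected theorem erase (h : MarkedDissection V D P) (hE : FreeEar V D P a v b) :
    MarkedDissection (V.erase v) (D.erase (chord a b)) P where
  isDiagonal e he := by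
    obtain ⟨hne, he⟩ := Finset.mem_erase.1 he
    obtain ⟨h₁, h₂, hlt, hside⟩ := h.isDiagonal e he
    rw [← h.chord_fst_snd he] at he
    have hv₁ : e.1 ≠ v := fun hv ↦ hE.chord_notMem e.2 (hv ▸ he)
    have hv₂ : e.2 ≠ v := fun hv ↦ hE.chord_notMem e.1 (hv ▸ chord_comm e.1 e.2 ▸ he)
    exact ⟨Finset.mem_erase.2 ⟨hv₁, h₁⟩, Finset.mem_erase.2 ⟨hv₂, h₂⟩, hlt,
      fun hs ↦ (hE.isSide_of_erase hs).elim hside hne⟩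
  not_crosses e he f hf :=
    h.not_crosses e (Finset.mem_of_mem_erase he) f (Finset.mem_of_mem_erase hf)
  subset := Finset.subset_erase.2 ⟨h.subset, hE.notMem⟩
  three_le_card := h.three_le_card
  isSide e he := by
    by_cases hab : e = chord a b
    · exact .inl (hab ▸ isSide_chord.2 (.inl hE.consecutive_erase))
    · refine (h.isSide e he).imp (fun hs ↦ hs.mono (Finset.erase_subset v V) ?_ ?_)
        fun hs ↦ Finset.mem_erase.2 ⟨hab, hs⟩
      · exact Finset.mem_erase.2 ⟨fun hv ↦ hE.notMem (hv ▸ he.1), h.subset he.1⟩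
      · exact Finset.mem_erase.2 ⟨fun hv ↦ hE.notMem (hv ▸ he.2.1), h.subset he.2.1⟩
  notMem e he hD := h.notMem e he (Finset.mem_of_mem_erase hD)

protected theorem insert (h : MarkedDissection (V.erase v) D P) (hE : Ear V a v b) :
    MarkedDissection V (insert (chord a b) D) P := by
  have hab : IsSide (V.erase v) (chord a b) := isSide_chord.2 (.inl hE.consecutive_erase)
  have hcross (e) (he : e ∈ D) : ¬ Crosses (chord a b) e :=
    h.chord_fst_snd he ▸ not_crosses_of_isSide hab (h.isDiagonal e he).1 (h.isDiagonal e he).2.1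
  refine ⟨fun e he ↦ ?_, fun e he f hf ↦ ?_, h.subset.trans (Finset.erase_subset v V),
    h.three_le_card, fun e he ↦ ?_, fun e he hD ↦ ?_⟩
  · rcases Finset.mem_insert.1 he with rfl | he
    · obtain ⟨x, hx, hxa, hxb⟩ := exists_mem_ne_ne h.three_le_card a b
      obtain ⟨hxv, hxV⟩ := Finset.mem_erase.1 (h.subset hx)
      exact hE.isDiagonal_chord hxV hxa hxv hxb
    · obtain ⟨h₁, h₂, hlt, hside⟩ := h.isDiagonal e he
      exact ⟨Finset.mem_of_mem_erase h₁, Finset.mem_of_mem_erase h₂, hlt,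
        fun hs ↦ hside (hs.mono (Finset.erase_subset v V) h₁ h₂)⟩
  · rcases Finset.mem_insert.1 he with rfl | he <;> rcases Finset.mem_insert.1 hf with rfl | hf
    · exact not_crosses_of_isSide hab hE.consecutive_erase.left_mem hE.consecutive_erase.right_mem
    · exact hcross f hf
    · exact fun hc ↦ hcross e he (crosses_comm.1 hc)
    · exact h.not_crosses e he f hf
  · rcases h.isSide e he with hs | hs
    · exact (hE.isSide_of_erase hs).imp_right fun hes ↦ Finset.mem_insert.2 (.inl hes)
    · exact .inr (Finset.mem_insert_of_mem hs)
  · rcases Finset.mem_insert.1 hD with rfl | hD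
    · exact he.2.2.2 (hab.mono h.subset he.1 he.2.1)
    · exact h.notMem e he hD

theorem card_add_card_le (h : MarkedDissection V D P) : D.card + P.card ≤ V.card := by
  induction hV : V using Finset.strongInduction generalizing V D with
  | H s ih =>
    subst hV
    by_cases hP : P = V
    · subst hP
      rw [Finset.eq_empty_of_forall_notMem fun e he ↦ h.notMem e (h.isDiagonal e he) he]
      simp
    · obtain ⟨a, v, b, hE⟩ := h.exists_freeEar hP
      have hle := ih _ (Finset.erase_ssubset hE.left.right_mem) (h.erase hE) rfl
      have hV := Finset.card_erase_add_one hE.left.right_mem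
      have hD := Finset.pred_card_le_card_erase (s := D) (a := chord a b)
      omega

end MarkedDissection

/-- The endpoint of `e` from which the arc that `e` cuts off from `P` is traversed in the positive
direction. -/
noncomputable def source (P : Finset (Fin n)) (e : Fin n × Fin n) : Fin n :=
  open Classical in if ∀ x ∈ P, ¬ sbtw e.1 x e.2 then e.1 else e.2

/-- The sources of the segments in `D`, with multiplicity: the multiset encoding a dissection with
a marked part. -/
noncomputable def sources (P : Finset (Fin n)) (D : Finset (Fin n × Fin n)) : Multiset (Fin n) :=
  D.val.map (source P)

theorem card_sources : Multiset.card (sources P D) = D.card :=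
  Multiset.card_map _ _

theorem source_mem_sources (he : e ∈ D) : source P e ∈ sources P D :=
  Multiset.mem_map_of_mem _ he

theorem source_chord (hP : 3 ≤ P.card) (hab : a ≠ b) (hPab : ∀ x ∈ P, ¬ sbtw a x b) :
    source P (chord a b) = a := by
  rcases lt_or_gt_of_ne hab with hlt | hlt
  · rw [chord_of_lt hlt]
    exact if_pos hPab
  · obtain ⟨p, hp, hbpa⟩ := exists_sbtw_of_not_sbtw hP hab hPab
    rw [chord_comm, chord_of_lt hlt]
    exact if_neg fun h ↦ h p hp hbpa

namespace MarkedDissection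

theorem exists_eq_chord_source (h : MarkedDissection V D P) (he : e ∈ D) :
    ∃ b, e = chord (source P e) b ∧ ∀ x ∈ P, ¬ sbtw (source P e) x b := by
  have hchord := h.chord_fst_snd he
  by_cases hP : ∀ x ∈ P, ¬ sbtw e.1 x e.2
  · rw [source, if_pos hP]
    exact ⟨e.2, hchord.symm, hP⟩
  · rw [source, if_neg hP]
    exact ⟨e.1, chord_comm e.1 e.2 ▸ hchord.symm,
      (h.not_sbtw_or_not_sbtw (by rwa [hchord])).resolve_left hP⟩

theorem exists_chord_of_mem_sources (h : MarkedDissection V D P) (ha : a ∈ sources P D) :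
    ∃ b, chord a b ∈ D ∧ ∀ x ∈ P, ¬ sbtw a x b := by
  obtain ⟨e, he, rfl⟩ := Multiset.mem_map.1 ha
  obtain ⟨b, heb, hPb⟩ := h.exists_eq_chord_source he
  exact ⟨b, heb ▸ he, hPb⟩

theorem mem_of_mem_sources (h : MarkedDissection V D P) (ha : a ∈ sources P D) : a ∈ V := by
  obtain ⟨b, hab, -⟩ := h.exists_chord_of_mem_sources ha
  exact h.left_mem hab

theorem freeEar_of_mem_sources (h : MarkedDissection V D P) (hE : Ear V a v b)
    (ha : a ∈ sources P D) (hv : v ∉ sources P D) : FreeEar V D P a v b := by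
  obtain ⟨c, hac, hPac⟩ := h.exists_chord_of_mem_sources ha
  have hcv : c ≠ v := by
    rintro rfl
    exact h.chord_notMem hE.left hac
  have havc : sbtw a v c := by
    rcases sbtw_or_sbtw hE.left.ne hcv.symm (h.ne hac).symm with h' | h'
    · exact h'
    · exact absurd h'.cyclic_left (hE.left.not_sbtw c (h.right_mem hac))
  refine ⟨hE, fun hvP ↦ hPac v hvP havc, fun w hvw ↦ ?_⟩
  rcases h.not_sbtw_or_not_sbtw hvw with hP | hP
  · exact hv (source_chord h.three_le_card (h.ne hvw) hP ▸ source_mem_sources hvw)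
  · rw [chord_comm] at hvw
    rcases h.eq_or_sbtw_of_chord_mem_right hac hPac havc hvw hP with rfl | hw
    · exact h.chord_notMem hE.left hvw
    · exact hE.left.not_sbtw w (h.left_mem hvw) hw

theorem sources_insert (h : MarkedDissection (V.erase v) D P) (hE : Ear V a v b) :
    sources P (insert (chord a b) D) = a ::ₘ sources P D := by
  rw [sources, Finset.insert_val_of_notMem (h.chord_notMem hE.consecutive_erase),
    Multiset.map_cons, source_chord h.three_le_card hE.ne fun x hx ↦
      hE.consecutive_erase.not_sbtw x (h.subset hx), sources]

end MarkedDissection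

/-- A marked dissection all of whose parts other than `P` are triangles. Each triangle cut off
accounts for one diagonal and for one vertex outside `P`, hence the encoding by cardinalities. -/
structure NearTriangulation (V : Finset (Fin n)) (D : Finset (Fin n × Fin n))
    (P : Finset (Fin n)) : Prop extends MarkedDissection V D P where
  card_add_card : D.card + P.card = V.card

namespace NearTriangulation

protected theorem refl (h : 3 ≤ V.card) : NearTriangulation V ∅ V where
  toMarkedDissection := .refl h
  card_add_card := by simp

theorem eq_empty_iff (h : NearTriangulation V D P) : D = ∅ ↔ P = V := by
  have hcard := h.card_add_card
  constructor
  · rintro rfl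
    exact Finset.eq_of_subset_of_card_le h.subset (by simpa using hcard.ge)
  · rintro rfl
    exact Finset.card_eq_zero.1 (by omega)

theorem chord_mem (h : NearTriangulation V D P) (hE : FreeEar V D P a v b) : chord a b ∈ D := by
  by_contra hn
  have hle := (h.erase hE).card_add_card_le
  rw [Finset.erase_eq_of_notMem hn] at hle
  have hlt := Finset.card_erase_lt_of_mem hE.left.right_mem
  have hcard := h.card_add_card
  omega

protected theorem erase (h : NearTriangulation V D P) (hE : FreeEar V D P a v b) :
    NearTriangulation (V.erase v) (D.erase (chord a b)) P where
  toMarkedDissection := h.toMarkedDissection.erase hE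
  card_add_card := by
    have hD := Finset.card_erase_add_one (h.chord_mem hE)
    have hV := Finset.card_erase_add_one hE.left.right_mem
    have hcard := h.card_add_card
    omega

protected theorem insert (h : NearTriangulation (V.erase v) D P) (hE : Ear V a v b) :
    NearTriangulation V (insert (chord a b) D) P where
  toMarkedDissection := h.toMarkedDissection.insert hE
  card_add_card := by
    rw [Finset.card_insert_of_notMem (h.chord_notMem hE.consecutive_erase)]
    have hV := Finset.card_erase_add_one hE.left.right_mem
    have hcard := h.card_add_card
    omega

theorem sources_eq_zero_iff (h : NearTriangulation V D P) : sources P D = 0 ↔ P = V := by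
  rw [← h.eq_empty_iff, ← Multiset.card_eq_zero, card_sources, Finset.card_eq_zero]

theorem sources_erase (h : NearTriangulation V D P) (hE : FreeEar V D P a v b) :
    sources P (D.erase (chord a b)) = (sources P D).erase a := by
  have hinsert := (h.erase hE).sources_insert hE.toEar
  rw [Finset.insert_erase (h.chord_mem hE)] at hinsert
  rw [hinsert, Multiset.erase_cons_head]

end NearTriangulation

theorem exists_ear_of_card_lt {M : Multiset (Fin n)} (hV : 3 ≤ V.card) (hM : ∀ x ∈ M, x ∈ V)
    (hlt : Multiset.card M < V.card) (h0 : M ≠ 0) :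
    ∃ a v b, Ear V a v b ∧ a ∈ M ∧ v ∉ M := by
  obtain ⟨x, hx⟩ := Multiset.exists_mem_of_ne_zero h0
  obtain ⟨y, hy, hyM⟩ :=
    Finset.exists_mem_notMem_of_card_lt_card (M.toFinset_card_le.trans_lt hlt)
  rw [Multiset.mem_toFinset] at hyM
  obtain ⟨a, v, hav, ha, hv⟩ := exists_consecutive_of_not (p := (· ∈ M)) (hM x hx) hx hy hyM
  obtain ⟨b, hE⟩ := hav.exists_ear hV
  exact ⟨a, v, b, hE, ha, hv⟩

theorem existsUnique_nearTriangulation {M : Multiset (Fin n)} (hM : ∀ x ∈ M, x ∈ V)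
    (hcard : Multiset.card M + 3 ≤ V.card) :
    ∃! p : Finset (Fin n × Fin n) × Finset (Fin n),
      NearTriangulation V p.1 p.2 ∧ sources p.2 p.1 = M := by
  induction hV : V using Finset.strongInduction generalizing V M with
  | H s ih =>
    subst hV
    by_cases h0 : M = 0
    · subst h0
      have hrefl : NearTriangulation V ∅ V := .refl (by simpa using hcard)
      refine ⟨(∅, V), ⟨hrefl, hrefl.sources_eq_zero_iff.2 rfl⟩, fun ⟨D, P⟩ ⟨h, hs⟩ ↦ ?_⟩
      have hP := h.sources_eq_zero_iff.1 hs
      exact Prod.ext (h.eq_empty_iff.2 hP) hP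
    obtain ⟨a, v, b, hE, ha, hv⟩ := exists_ear_of_card_lt (by omega) hM (by omega) h0
    have hcardV := Finset.card_erase_add_one hE.left.right_mem
    have hcardM := Multiset.card_erase_add_one ha
    have hMv : ∀ x ∈ M.erase a, x ∈ V.erase v := fun x hx ↦ Finset.mem_erase.2
      ⟨fun hxv ↦ hv (hxv ▸ Multiset.mem_of_mem_erase hx), hM x (Multiset.mem_of_mem_erase hx)⟩
    obtain ⟨⟨D, P⟩, ⟨h, hs⟩, huniq⟩ :=
      ih _ (Finset.erase_ssubset hE.left.right_mem) hMv (by omega) rfl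
    refine ⟨(insert (chord a b) D, P), ⟨h.insert hE, ?_⟩, fun ⟨D', P'⟩ ⟨h', hs'⟩ ↦ ?_⟩
    · rw [h.sources_insert hE, hs, Multiset.cons_erase ha]
    · have hF : FreeEar V D' P' a v b := h'.freeEar_of_mem_sources hE (hs' ▸ ha) (hs' ▸ hv)
      have heq := huniq (D'.erase (chord a b), P') ⟨h'.erase hF, by rw [h'.sources_erase hF, hs']⟩
      rw [Prod.mk.injEq] at heq ⊢
      exact ⟨heq.1 ▸ (Finset.insert_erase (h'.chord_mem hF)).symm, heq.2⟩

open Classical in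
theorem card_nearTriangulation {k : ℕ} (hk : 3 ≤ k) (hkV : k ≤ V.card) :
    (Finset.univ.filter fun p : Finset (Fin n × Fin n) × Finset (Fin n) ↦
      NearTriangulation V p.1 p.2 ∧ p.2.card = k).card = (V.sym (V.card - k)).card := by
  have hcard {p : Finset (Fin n × Fin n) × Finset (Fin n)} (h : NearTriangulation V p.1 p.2) :
      p.2.card = k ↔ Multiset.card (sources p.2 p.1) = V.card - k := by
    have hV := h.card_add_card
    rw [card_sources]
    omega
  refine Finset.card_bij
    (fun p hp ↦ ⟨sources p.2 p.1,
      (hcard (Finset.mem_filter.1 hp).2.1).1 (Finset.mem_filter.1 hp).2.2⟩)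
    (fun p hp ↦ ?_) (fun p hp q hq hpq ↦ ?_) fun M hM ↦ ?_
  · exact Finset.mem_sym_iff.2 fun x ↦ (Finset.mem_filter.1 hp).2.1.mem_of_mem_sources
  · obtain ⟨-, h, hP⟩ := Finset.mem_filter.1 hp
    obtain ⟨-, h', -⟩ := Finset.mem_filter.1 hq
    have hM : ∀ x ∈ sources p.2 p.1, x ∈ V := fun x ↦ h.mem_of_mem_sources
    have hMcard : Multiset.card (sources p.2 p.1) + 3 ≤ V.card := by rw [(hcard h).1 hP]; omega
    exact (existsUnique_nearTriangulation hM hMcard).unique ⟨h, rfl⟩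
      ⟨h', (congrArg Subtype.val hpq).symm⟩
  · have hMcard : Multiset.card M.1 = V.card - k := M.2
    obtain ⟨p, ⟨h, hs⟩, -⟩ :=
      existsUnique_nearTriangulation (Finset.mem_sym_iff.1 hM) (by rw [hMcard]; omega)
    exact ⟨p, Finset.mem_filter.2 ⟨Finset.mem_univ p, h, (hcard h).2 (hs ▸ M.2)⟩, Subtype.ext hs⟩

theorem MarkedDissection.eq_of_empty (h : MarkedDissection V ∅ P) : P = V := by
  by_contra hP
  obtain ⟨y, hy, hyP⟩ := Finset.exists_of_ssubset (h.subset.ssubset_of_ne hP)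
  obtain ⟨x, hx, -⟩ := exists_mem_ne_ne h.three_le_card y y
  obtain ⟨a, v, hav, ha, hv⟩ := exists_consecutive_of_not (p := (· ∈ P)) (h.subset hx) hx hy hyP
  obtain ⟨b, hab⟩ := exists_consecutive_left h.three_le_card ha
  have hvb : v = b := hav.right_unique (h.consecutive hab (Finset.notMem_empty _))
  exact hv (hvb ▸ hab.right_mem)

theorem MarkedDissection.eq_triple (h : MarkedDissection V D P) (hE : Ear V a v b)
    (hv : ∀ w, chord v w ∉ D) (hab : chord a b ∈ D) (hvP : v ∈ P) : P = {a, v, b} := by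
  obtain ⟨x, hxv⟩ := exists_consecutive_right h.three_le_card hvP
  obtain ⟨y, hvy⟩ := exists_consecutive_left h.three_le_card hvP
  obtain rfl : x = a := (h.consecutive hxv (chord_comm v x ▸ hv x)).left_unique hE.left
  obtain rfl : y = b := (h.consecutive hvy (hv y)).right_unique hE.right
  have hEP : Ear P x v y := ⟨hxv, hvy, hE.ne⟩
  ext z
  simp only [Finset.mem_insert, Finset.mem_singleton]
  refine ⟨fun hz ↦ ?_, ?_⟩
  · by_contra! hne
    exact h.notMem _ (hEP.isDiagonal_chord hz hne.1 hne.2.1 hne.2.2) hab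
  · rintro (rfl | rfl | rfl)
    exacts [hxv.left_mem, hvP, hvy.right_mem]

theorem eq_chord_of_isSide_triple (he : IsSide {a, v, b} e) :
    e = chord a v ∨ e = chord v b ∨ e = chord a b := by
  obtain ⟨h₁, h₂, hlt, -⟩ := he
  rw [← chord_fst_snd hlt]
  simp only [Finset.mem_insert, Finset.mem_singleton, chord] at *
  grind

theorem MarkedDissection.triple (h : MarkedDissection V D P) (hE : Ear V a v b)
    (hab : chord a b ∈ D) : MarkedDissection V D {a, v, b} where
  isDiagonal := h.isDiagonal
  not_crosses := h.not_crosses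
  subset := by
    simp only [Finset.insert_subset_iff, Finset.singleton_subset_iff]
    exact ⟨hE.left.left_mem, hE.left.right_mem, hE.right.right_mem⟩
  three_le_card := hE.card_triple.ge
  isSide e he := by
    rcases eq_chord_of_isSide_triple he with rfl | rfl | rfl
    · exact .inl (isSide_chord.2 (.inl hE.left))
    · exact .inl (isSide_chord.2 (.inl hE.right))
    · exact .inr hab
  notMem e he := absurd he.four_le_card (by rw [hE.card_triple]; decide)

/-- The parts into which the segments in `D` cut the polygon with vertex set `V`. -/
noncomputable def partsOf (V : Finset (Fin n)) (D : Finset (Fin n × Fin n)) :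
    Finset (Finset (Fin n)) :=
  open Classical in {P | MarkedDissection V D P}

theorem mem_partsOf : P ∈ partsOf V D ↔ MarkedDissection V D P := by
  classical exact Finset.mem_filter_univ P

theorem partsOf_empty (hV : 3 ≤ V.card) : partsOf V ∅ = {V} := by
  ext Q
  rw [mem_partsOf, Finset.mem_singleton]
  exact ⟨MarkedDissection.eq_of_empty, by rintro rfl; exact .refl hV⟩

theorem FreeEar.partsOf_eq (hE : FreeEar V D P a v b) (h : MarkedDissection V D P)
    (hab : chord a b ∈ D) :
    partsOf V D = insert {a, v, b} (partsOf (V.erase v) (D.erase (chord a b))) := by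
  ext Q
  simp only [Finset.mem_insert, mem_partsOf]
  constructor
  · intro hQ
    by_cases hv : v ∈ Q
    · exact .inl (hQ.eq_triple hE.toEar hE.chord_notMem hab hv)
    · exact .inr (hQ.erase ⟨hE.toEar, hv, hE.chord_notMem⟩)
  · rintro (rfl | hQ)
    · exact h.triple hE.toEar hab
    · exact Finset.insert_erase hab ▸ hQ.insert hE.toEar

theorem NearTriangulation.map_card_partsOf (h : NearTriangulation V D P) :
    (partsOf V D).val.map Finset.card = P.card ::ₘ Multiset.replicate (V.card - P.card) 3 := by
  induction hV : V using Finset.strongInduction generalizing V D with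
  | H s ih =>
    subst hV
    by_cases hP : P = V
    · obtain rfl := h.eq_empty_iff.2 hP
      subst hP
      simp [partsOf_empty h.three_le_card]
    obtain ⟨a, v, b, hE⟩ := h.exists_freeEar hP
    have hcard := Finset.card_erase_add_one hE.left.right_mem
    have hle := Finset.card_le_card (h.erase hE).subset
    have hnotMem : {a, v, b} ∉ partsOf (V.erase v) (D.erase (chord a b)) := fun hT ↦
      Finset.notMem_erase v V ((mem_partsOf.1 hT).subset (by simp))
    rw [hE.partsOf_eq h.toMarkedDissection (h.chord_mem hE), Finset.insert_val_of_notMem hnotMem,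
      Multiset.map_cons, ih _ (Finset.erase_ssubset hE.left.right_mem) (h.erase hE) rfl,
      hE.card_triple, Multiset.cons_swap, ← Multiset.replicate_succ]
    congr 2
    omega

theorem isPart_iff {m : ℕ} (hD : IsDissection m D) :
    IsPart D P ↔ MarkedDissection Finset.univ D P :=
  ⟨fun h ↦ ⟨hD.2.1, hD.2.2, Finset.subset_univ P, h.1, h.2.1, h.2.2⟩,
    fun h ↦ ⟨h.three_le_card, h.isSide, h.notMem⟩⟩

theorem parts_eq_partsOf {m : ℕ} (hD : IsDissection m D) : parts D = partsOf Finset.univ D := by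
  ext P
  rw [parts, Finset.mem_filter_univ, isPart_iff hD, mem_partsOf]

theorem nearTriangulation_and_card_iff {k : ℕ} (hkn : k ≤ n) :
    NearTriangulation Finset.univ D P ∧ P.card = k ↔
      IsDissection (n - k) D ∧ P ∈ parts D ∧ P.card = k := by
  constructor
  · rintro ⟨h, hk⟩
    have hcard : D.card + P.card = n := h.card_add_card.trans (Finset.card_fin n)
    have hD : IsDissection (n - k) D := ⟨by omega, h.isDiagonal, h.not_crosses⟩
    exact ⟨hD, parts_eq_partsOf hD ▸ mem_partsOf.2 h.toMarkedDissection, hk⟩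
  · rintro ⟨hD, hP, hk⟩
    refine ⟨⟨mem_partsOf.1 (parts_eq_partsOf hD ▸ hP), ?_⟩, hk⟩
    rw [hD.1, Finset.card_fin]
    omega

theorem isKInN_iff {k : ℕ} (hkn : k ≤ n) :
    IsKInN k D ↔ ∃ P, NearTriangulation Finset.univ D P ∧ P.card = k := by
  simp only [nearTriangulation_and_card_iff hkn]
  constructor
  · rintro ⟨hD, hparts⟩
    obtain ⟨P, hP, hk⟩ := Multiset.mem_map.1 (hparts ▸ Multiset.mem_cons_self k _)
    exact ⟨P, hD, hP, hk⟩
  · rintro ⟨P, hP⟩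
    obtain ⟨h, hk⟩ := (nearTriangulation_and_card_iff hkn).2 hP
    refine ⟨hP.1, ?_⟩
    rw [parts_eq_partsOf hP.1, h.map_card_partsOf, Finset.card_fin, hk]

theorem NearTriangulation.eq_of_card_ne_three {Q : Finset (Fin n)} (h : NearTriangulation V D P)
    (hP : P.card ≠ 3) (hQ : MarkedDissection V D Q) (hPQ : Q.card = P.card) : Q = P := by
  have hcount := congrArg (Multiset.count P.card) h.map_card_partsOf
  rw [Multiset.count_map, Multiset.count_cons_self, Multiset.count_replicate,
    if_neg hP.symm] at hcount
  have hle : ((partsOf V D).filter fun R ↦ P.card = R.card).card ≤ 1 := hcount.le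
  exact Finset.card_le_one.1 hle Q (by simp [mem_partsOf, hQ, hPQ]) P
    (by simp [mem_partsOf, h.toMarkedDissection])

open Classical in
theorem f_eq_card_nearTriangulation {k : ℕ} (hkn : k ≤ n) :
    f k n = (Finset.univ.filter fun p : Finset (Fin n × Fin n) × Finset (Fin n) ↦
      NearTriangulation Finset.univ p.1 p.2 ∧ p.2.card = k).card := by
  rw [f]
  split_ifs with hk
  · subst hk
    congr 1
    ext p
    rw [Finset.mem_filter_univ, Finset.mem_filter_univ, nearTriangulation_and_card_iff hkn]
    rfl
  · symm
    refine Finset.card_bij (fun p _ ↦ p.1) (fun p hp ↦ ?_) (fun p hp q hq hpq ↦ ?_) fun D hD ↦ ?_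
    · exact Finset.mem_filter.2
        ⟨Finset.mem_univ _, (isKInN_iff hkn).2 ⟨p.2, (Finset.mem_filter.1 hp).2⟩⟩
    · obtain ⟨-, hpT, hpk⟩ := Finset.mem_filter.1 hp
      obtain ⟨-, hqT, hqk⟩ := Finset.mem_filter.1 hq
      exact Prod.ext hpq (hqT.eq_of_card_ne_three (hqk ▸ hk) (hpq ▸ hpT.toMarkedDissection)
        (hpk.trans hqk.symm))
    · obtain ⟨P, hP⟩ := (isKInN_iff hkn).1 (Finset.mem_filter.1 hD).2
      exact ⟨(D, P), Finset.mem_filter.2 ⟨Finset.mem_univ _, hP⟩, rfl⟩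

end MarkedDissection

end PolygonDissection

theorem mainTheorem2 (k n : ℕ) (hk : 3 ≤ k) (hkn : k ≤ n) :
    PolygonDissection.f k n = Nat.choose (2 * n - k - 1) (n - 1) := by
  classical
  have hcard : (Finset.univ : Finset (Fin n)).card = n := Finset.card_fin n
  rw [PolygonDissection.f_eq_card_nearTriangulation hkn,
    PolygonDissection.card_nearTriangulation hk (hkn.trans hcard.ge), hcard, Finset.sym_univ,
    Finset.card_univ, Sym.card_sym_eq_choose, Fintype.card_fin,
    show n + (n - k) - 1 = 2 * n - k - 1 by omega]
  exact Nat.choose_symm_of_eq_add (by omega)
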